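/- \textbf{Trees.} All trees are finite, rooted and ordered. Write $\bullet$ for the single-node tree and $(T_1,\dots,T_d)$ for the tree whose root has $d$ children with subtrees $T_1,\dots,T_d$ from left to right; the mirror image $T^{\mathrm m}$ of $T$ is obtained by reversing the order of the children at every node. For a tree $L$ put $$S_1(L)=(L,L,(L,L)),\quad S_2(L)=(L,L,(L,L),L),\quad S_3(L)=(L,L,S_1(L)),\quad S_4(L)=(L,L,S_2(L)),$$ and for $j\in\{1,2,3,4\}$ let $$T_j=\bigl(\bullet,\ S_j(\bullet)^{\mathrm m},\ S_j((\bullet,\bullet)),\ \bullet\bigr).$$ \textbf{Drawings.} A straight-line drawing of a tree assigns to every node a point of the plane with integral $x$-coordinate (and real $y$-coordinate); every edge is drawn as the straight segment between its ends. It is \emph{planar} if distinct nodes are at distinct points, no edge contains a node other than its ends, and two distinct edges meet at most in a common end. It is \emph{upward} if no child is above its parent (horizontal edges are allowed). It is \emph{order-preserving} if at every node the edges to the children leave in the given order from left to right, i.e. with strictly increasing angle, turning counterclockwise from due left through straight down to due right. Its \emph{width} is the smallest $W$ such that, after a suitable horizontal translation by an integer, all $x$-coordinates are in $\{1,\dots,W\}$;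 for a drawing of width $W$ so translated, column $X$ is the vertical line with $x$-coordinate $X$. \textbf{Theorem.} For every $j\in\{1,2,3,4\}$, the tree $T_j$ is quaternary (every node has at most $4$ children) and has a planar upward order-preserving straight-line drawing of width $3$; and in every planar upward order-preserving straight-line drawing of $T_j$ of width $3$ the root lies in the middle column, that is, in column $2$ (so it is never in a corner). -/

import Mathlib

/-- A finite rooted ordered tree: the root together with the subtrees of its children,
listed from left to right. -/
inductive OrdTree : Type where
  | node : List OrdTree → OrdTree

namespace OrdTree

/-- The subtrees rooted at the children of the root, from left to right. -/
def children : OrdTree → List OrdTree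
  | node ts => ts

/-- The subtree rooted at the node with address `p`, if there is such a node.
The root has address `[]`; if a node has address `p`, then its children have, from left to right,
the addresses `p ++ [0]`, `p ++ [1]`, `p ++ [2]`, … -/
def subtree? : OrdTree → List ℕ → Option OrdTree
  | t, [] => some t
  | t, i :: p =>
    match t.children[i]? with
    | some s => s.subtree? p
    | none => none

/-- `p` is the address of a node of `t`. -/
def IsNode (t : OrdTree) (p : List ℕ) : Prop := (t.subtree? p).isSome = true

/-- Every node has at most four children. -/
def IsQuaternary (t : OrdTree) : Prop :=
  ∀ p s, t.subtree? p = some s → s.children.length ≤ 4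

mutual
/-- The tree obtained by reversing the order of the children at every node. -/
def mirror : OrdTree → OrdTree
  | node ts => node (mirrorList ts)
/-- Mirror every tree of a list and reverse the list. -/
def mirrorList : List OrdTree → List OrdTree
  | [] => []
  | t :: ts => mirrorList ts ++ [mirror t]
end

/-- The tree with a single node. -/
def leaf : OrdTree := node []

/-- The binary tree with a root and two leaves. -/
def cherry : OrdTree := node [leaf, leaf]

/-- The children of the root are two copies of `L`, then a node with two copies of `L` below it,
and then, if `fourth` is set, one more copy of `L`. -/
def lowerPart (fourth : Bool) (L : OrdTree) : OrdTree :=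
  if fourth then node [L, L, node [L, L], L] else node [L, L, node [L, L]]

/-- `lowerPart`, optionally below a new root whose first two children are copies of `L`. -/
def gadget (upper fourth : Bool) (L : OrdTree) : OrdTree :=
  if upper then node [L, L, lowerPart fourth L] else lowerPart fourth L

/-- The root has four children: a leaf, the mirrored gadget with single nodes as `L`,
the gadget with cherries as `L`, and a leaf. -/
def notCornerTree (upper fourth : Bool) : OrdTree :=
  node [leaf, (gadget upper fourth leaf).mirror, gadget upper fourth cherry, leaf]

end OrdTree

/-- Positions for the nodes of a tree in a straight-line drawing: integral `x`-coordinates and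
real `y`-coordinates, indexed by addresses (only the values at nodes of the tree matter).
An edge is drawn as the segment between its ends. -/
structure TreeDrawing : Type where
  x : List ℕ → ℤ
  y : List ℕ → ℝ

namespace TreeDrawing

variable (d : TreeDrawing) (t : OrdTree)

/-- The point of the plane at which a node is drawn. -/
noncomputable def point (p : List ℕ) : ℝ × ℝ := ((d.x p : ℝ), d.y p)

/-- The segment representing the edge from the node `p` to its child `p ++ [i]`. -/
noncomputable def edge (p : List ℕ) (i : ℕ) : Set (ℝ × ℝ) :=
  segment ℝ (d.point p) (d.point (p ++ [i]))

/-- Distinct nodes are at distinct points, an edge contains no node other than its two ends, and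
two distinct edges meet at most in a common end. -/
structure IsPlanar : Prop where
  injective : ∀ p q, t.IsNode p → t.IsNode q → d.point p = d.point q → p = q
  node_edge : ∀ q p i, t.IsNode q → t.IsNode (p ++ [i]) → d.point q ∈ d.edge p i →
    q = p ∨ q = p ++ [i]
  edge_edge : ∀ p i q j, t.IsNode (p ++ [i]) → t.IsNode (q ++ [j]) → p ++ [i] ≠ q ++ [j] →
    ∀ z ∈ d.edge p i ∩ d.edge q j,
      ∃ v, (v = p ∨ v = p ++ [i]) ∧ (v = q ∨ v = q ++ [j]) ∧ z = d.point v

/-- No child is above its parent (horizontal edges are allowed). -/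
def IsUpward : Prop :=
  ∀ p i, t.IsNode (p ++ [i]) → d.y (p ++ [i]) ≤ d.y p

/-- For directions `u`, `v` in the closed lower half-plane: turning counterclockwise from the
direction due left over straight down to due right, `u` comes strictly before `v`. -/
def LeftOf (u v : ℝ × ℝ) : Prop :=
  0 < u.1 * v.2 - u.2 * v.1 ∨ (u.2 = 0 ∧ v.2 = 0 ∧ u.1 < 0 ∧ 0 < v.1)

/-- At every node the edges to the children leave in the prescribed order from left to right. -/
def IsOrderPreserving : Prop :=
  ∀ p i j, t.IsNode (p ++ [i]) → t.IsNode (p ++ [j]) → i < j →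
    LeftOf (d.point (p ++ [i]) - d.point p) (d.point (p ++ [j]) - d.point p)

/-- After translation by `s`, all `x`-coordinates are between `1` and `W`. -/
def FitsColumns (s : ℤ) (W : ℕ) : Prop :=
  ∀ p, t.IsNode p → 1 ≤ d.x p + s ∧ d.x p + s ≤ W

/-- The width is the smallest `W` such that the drawing fits, after translation, into the columns
`1, …, W`. -/
def HasWidth (W : ℕ) : Prop :=
  IsLeast {W' : ℕ | ∃ s : ℤ, d.FitsColumns t s W'} W

/-- A planar upward order-preserving straight-line drawing of `t`. -/
structure IsPlanarUpwardOrderPreserving : Prop where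
  planar : d.IsPlanar t
  upward : d.IsUpward t
  orderPreserving : d.IsOrderPreserving t

end TreeDrawing

/-!
The root is forced into the middle column as follows. Two edges that both meet two columns cannot
be in different vertical order there (`no_cross`). This gives the two obstructions used throughout:
a node above an edge, but not above its upper end, has no child at or beyond the column of that end
(`shield`), and when one child of a node is straight below it, that child and another one cannot
both have edges that reach across the other's column (`down_side`).

In three columns, a node with three children all of which have at least two children is not in the
middle column (`x_ne_two`): the second child would have to be straight below and the others one on
each side, and their edges back to the middle column leave no room for the two children of the
second child. If moreover the two children of the third child have at least two children, the node
is not in the first column either (`x_ne_one`). So the third child of the root of the given tree,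
whose subtree is the gadget with cherries, is in column `3`. The root is not in column `3`, since
its fourth child would have to lie even further to the right. If the root were in column `1`,
consider the first child of the third child of the root (`x_third_ne_three`): by `above_or_cut_off`
it either lies above the edge from the root to its second child, in a triangle too narrow for its
two children, or the edge to it cuts the second child of the root off from column `3`, and then the
mirrored gadget does not fit into the two remaining columns.

A drawing of width three is given by integral coordinates, and its properties reduce to finitely
many sign conditions on integers (`Layout.Certificate`). Width two is impossible because such a
drawing would fit into three columns after two different translations, and the root cannot be in
the middle column after both of them.
-/

/-! ### Heights of edges over columns -/

namespace TreeDrawing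

variable {d : TreeDrawing} {t : OrdTree}

/-- The height at which the line through the edge from `p` to `p ++ [i]` meets column `c`.
This is meaningful for edges that are not vertical; for a vertical edge it is `d.y p`. -/
noncomputable def height (d : TreeDrawing) (p : List ℕ) (i : ℕ) (c : ℤ) : ℝ :=
  d.y p + (d.y (p ++ [i]) - d.y p) / (d.x (p ++ [i]) - d.x p) * (c - d.x p)

/-- The edge from `p` to `p ++ [i]` meets column `c`. -/
def Spans (d : TreeDrawing) (p : List ℕ) (i : ℕ) (c : ℤ) : Prop :=
  d.x p ≤ c ∧ c ≤ d.x (p ++ [i]) ∨ d.x (p ++ [i]) ≤ c ∧ c ≤ d.x p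

theorem height_parent {p : List ℕ} (i : ℕ) {c : ℤ} (h : d.x p = c) : d.height p i c = d.y p := by
  simp [height, h]

theorem height_child {p : List ℕ} {i : ℕ} {c : ℤ} (h : d.x (p ++ [i]) = c) (hc : d.x p ≠ c) :
    d.height p i c = d.y (p ++ [i]) := by
  have : (c : ℝ) - d.x p ≠ 0 := sub_ne_zero.2 (by exact_mod_cast hc.symm)
  rw [height, h, div_mul_cancel₀ _ this]
  ring

theorem mem_edge_of_combo (p : List ℕ) (i : ℕ) {z : ℝ × ℝ} {τ : ℝ} (h0 : 0 ≤ τ) (h1 : τ ≤ 1)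
    (hx : z.1 = d.x p + τ * (d.x (p ++ [i]) - d.x p))
    (hy : z.2 = d.y p + τ * (d.y (p ++ [i]) - d.y p)) : z ∈ d.edge p i := by
  refine ⟨1 - τ, τ, by linarith, h0, by ring, ?_⟩
  ext
  · simp [point, hx]; ring
  · simp [point, hy]; ring

/-- A real number between the ends of a non-vertical edge gives a point of the edge. -/
theorem mem_edge_of_between {p : List ℕ} {i : ℕ} {c : ℝ} (hne : d.x p ≠ d.x (p ++ [i]))
    (hc : (d.x p : ℝ) ≤ c ∧ c ≤ d.x (p ++ [i]) ∨ (d.x (p ++ [i]) : ℝ) ≤ c ∧ c ≤ d.x p) :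
    (c, d.y p + (d.y (p ++ [i]) - d.y p) / (d.x (p ++ [i]) - d.x p) * (c - d.x p))
      ∈ d.edge p i := by
  have hne' : (d.x (p ++ [i]) : ℝ) - d.x p ≠ 0 := sub_ne_zero.2 (by exact_mod_cast hne.symm)
  refine mem_edge_of_combo p i (τ := (c - d.x p) / (d.x (p ++ [i]) - d.x p)) ?_ ?_ ?_ ?_
  · rcases hc with hc | hc
    · exact div_nonneg (by linarith) (by linarith)
    · exact div_nonneg_of_nonpos (by linarith) (by linarith)
  · rcases hc with hc | hc
    · exact div_le_one_of_le₀ (by linarith) (by linarith)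
    · exact div_le_one_of_ge (by linarith) (by linarith)
  · field_simp; ring
  · field_simp

theorem Spans.mem_edge {p : List ℕ} {i : ℕ} {c : ℤ} (hc : d.Spans p i c)
    (hne : d.x p ≠ d.x (p ++ [i])) : ((c : ℝ), d.height p i c) ∈ d.edge p i :=
  mem_edge_of_between hne (by unfold Spans at hc; exact_mod_cast hc)

/-- A point on a vertical line between the ends of a vertical edge lies on the edge. -/
theorem mem_edge_of_vertical {p : List ℕ} {i : ℕ} {h : ℝ} (hx : d.x (p ++ [i]) = d.x p)
    (hlow : d.y (p ++ [i]) ≤ h) (hupp : h ≤ d.y p) : ((d.x p : ℝ), h) ∈ d.edge p i := by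
  rcases eq_or_lt_of_le (hlow.trans hupp) with he | hlt
  · exact mem_edge_of_combo p i (τ := 0) le_rfl zero_le_one (by simp)
      (by simp; linarith)
  · refine mem_edge_of_combo p i (τ := (d.y p - h) / (d.y p - d.y (p ++ [i]))) ?_ ?_ ?_ ?_
    · exact div_nonneg (by linarith) (by linarith)
    · exact div_le_one_of_le₀ (by linarith) (by linarith)
    · simp [hx]
    · have : d.y p - d.y (p ++ [i]) ≠ 0 := by linarith
      field_simp; ring

namespace IsPlanarUpwardOrderPreserving

variable (hd : d.IsPlanarUpwardOrderPreserving t)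
include hd

theorem height_le {p : List ℕ} {i : ℕ} {c : ℤ} (hi : t.IsNode (p ++ [i])) (hc : d.Spans p i c) :
    d.height p i c ≤ d.y p := by
  have hy := hd.upward p i hi
  have : 0 ≤ ((c : ℝ) - d.x p) / (d.x (p ++ [i]) - d.x p) := by
    rcases hc with hc | hc
    · have h1 : (d.x p : ℝ) ≤ c := by exact_mod_cast hc.1
      have h2 : (c : ℝ) ≤ d.x (p ++ [i]) := by exact_mod_cast hc.2
      exact div_nonneg (by linarith) (by linarith)
    · have h1 : (d.x (p ++ [i]) : ℝ) ≤ c := by exact_mod_cast hc.1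
      have h2 : (c : ℝ) ≤ d.x p := by exact_mod_cast hc.2
      exact div_nonneg_of_nonpos (by linarith) (by linarith)
  have key : d.height p i c = d.y p +
      (d.y (p ++ [i]) - d.y p) * (((c : ℝ) - d.x p) / (d.x (p ++ [i]) - d.x p)) := by
    rw [height]; ring
  rw [key]
  nlinarith

/-- A node does not lie on an edge of which it is not an end. -/
theorem height_ne {p w : List ℕ} {i : ℕ} (hi : t.IsNode (p ++ [i])) (hw : t.IsNode w)
    (hc : d.Spans p i (d.x w)) (hne : d.x p ≠ d.x (p ++ [i])) (hp : w ≠ p) (hpi : w ≠ p ++ [i]) :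
    d.height p i (d.x w) ≠ d.y w := by
  intro h
  have := hc.mem_edge hne
  rw [h] at this
  exact (hd.planar.node_edge w p i hw hi this).elim hp hpi

theorem y_ne {p q : List ℕ} (hp : t.IsNode p) (hq : t.IsNode q) (hx : d.x p = d.x q)
    (hne : p ≠ q) : d.y p ≠ d.y q := fun h =>
  hne (hd.planar.injective p q hp hq (by simp [point, hx, h]))

/-- Two edges do not change their vertical order between two columns that both of them meet:
otherwise they would have a common point which is an end of neither. -/
theorem no_cross {p q : List ℕ} {i j : ℕ} {c c' : ℤ} (hi : t.IsNode (p ++ [i]))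
    (hj : t.IsNode (q ++ [j])) (hpc : d.Spans p i c) (hqc : d.Spans q j c)
    (hpc' : d.Spans p i c') (hqc' : d.Spans q j c') (h : d.height p i c < d.height q j c)
    (h' : d.height q j c' < d.height p i c') : False := by
  have hcc : c ≠ c' := by rintro rfl; exact lt_asymm h h'
  have hnp : d.x p ≠ d.x (p ++ [i]) := by unfold Spans at hpc hpc'; omega
  have hnq : d.x q ≠ d.x (q ++ [j]) := by unfold Spans at hqc hqc'; omega
  set g := d.height q j c - d.height p i c with hg
  set g' := d.height p i c' - d.height q j c' with hg'
  have g0 : 0 < g := sub_pos.2 h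
  have g0' : 0 < g' := sub_pos.2 h'
  set τ := g / (g + g') with hτ
  have τ0 : 0 < τ := by positivity
  have τ1 : τ < 1 := by rw [hτ, div_lt_one (by positivity)]; linarith
  have τg : τ * (g + g') = g := by rw [hτ]; field_simp
  -- the column at which the difference of the two heights vanishes
  set e : ℝ := c + τ * (c' - c) with he
  have strict : (c : ℝ) < e ∧ e < c' ∨ (c' : ℝ) < e ∧ e < c := by
    rcases lt_or_gt_of_ne hcc with hlt | hlt
    · have : (c : ℝ) < c' := by exact_mod_cast hlt
      left; constructor <;> nlinarith
    · have : (c' : ℝ) < c := by exact_mod_cast hlt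
      right; constructor <;> nlinarith
  have inner : ∀ {u : List ℕ} {k : ℕ}, d.Spans u k c → d.Spans u k c' →
      (d.x u : ℝ) < e ∧ e < d.x (u ++ [k]) ∨ (d.x (u ++ [k]) : ℝ) < e ∧ e < d.x u := by
    intro u k h1 h2
    have h1' : (d.x u : ℝ) ≤ c ∧ (c : ℝ) ≤ d.x (u ++ [k]) ∨
        (d.x (u ++ [k]) : ℝ) ≤ c ∧ (c : ℝ) ≤ d.x u := by unfold Spans at h1; exact_mod_cast h1
    have h2' : (d.x u : ℝ) ≤ c' ∧ (c' : ℝ) ≤ d.x (u ++ [k]) ∨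
        (d.x (u ++ [k]) : ℝ) ≤ c' ∧ (c' : ℝ) ≤ d.x u := by unfold Spans at h2; exact_mod_cast h2
    rcases strict with s | s <;> rcases h1' with a | a <;> rcases h2' with b | b <;>
      first
        | (left; constructor <;> linarith)
        | (right; constructor <;> linarith)
  have ip := inner hpc hpc'
  have iq := inner hqc hqc'
  have mp := mem_edge_of_between hnp (c := e) (by rcases ip with a | a <;> [left; right] <;>
    exact ⟨a.1.le, a.2.le⟩)
  have mq := mem_edge_of_between hnq (c := e) (by rcases iq with a | a <;> [left; right] <;>
    exact ⟨a.1.le, a.2.le⟩)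
  have same : d.y p + (d.y (p ++ [i]) - d.y p) / (d.x (p ++ [i]) - d.x p) * (e - d.x p) =
      d.y q + (d.y (q ++ [j]) - d.y q) / (d.x (q ++ [j]) - d.x q) * (e - d.x q) := by
    simp only [height] at hg hg'
    rw [he]
    clear_value g g' τ
    linear_combination τg + (1 - τ) * hg - τ * hg'
  rw [← same] at mq
  have hne : p ++ [i] ≠ q ++ [j] := by
    intro heq
    obtain ⟨rfl, h2⟩ := List.append_inj' heq rfl
    obtain rfl : i = j := by simpa using h2
    exact lt_irrefl _ h
  obtain ⟨v, hv, -, hz⟩ := hd.planar.edge_edge p i q j hi hj hne _ ⟨mp, mq⟩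
  have hex : e = d.x v := congrArg Prod.fst hz
  rcases hv with rfl | rfl <;> rcases ip with a | a <;> linarith [a.1, a.2]

/-- An edge that meets the column of a vertical edge not above its upper end, and shares no end
with it, passes below its lower end. -/
theorem height_lt_of_vertical {p q : List ℕ} {i j : ℕ} (hi : t.IsNode (p ++ [i]))
    (hj : t.IsNode (q ++ [j])) (hx : d.x (p ++ [i]) = d.x p) (hc : d.Spans q j (d.x p))
    (hne : d.x q ≠ d.x (q ++ [j])) (h : d.height q j (d.x p) ≤ d.y p) (h1 : p ≠ q)
    (h2 : p ++ [i] ≠ q) (h3 : p ≠ q ++ [j]) (h4 : p ++ [i] ≠ q ++ [j]) :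
    d.height q j (d.x p) < d.y (p ++ [i]) := by
  by_contra! hle
  obtain ⟨v, hv, hw, -⟩ := hd.planar.edge_edge p i q j hi hj h4 _
    ⟨mem_edge_of_vertical hx hle h, hc.mem_edge hne⟩
  rcases hv with rfl | rfl <;> rcases hw with hw | hw <;> contradiction

/-! ### Consequences of the order of the children -/

theorem lt_x_of_le {p : List ℕ} {i j : ℕ} (hi : t.IsNode (p ++ [i])) (hj : t.IsNode (p ++ [j]))
    (hij : i < j) (h : d.x p ≤ d.x (p ++ [i])) : d.x p < d.x (p ++ [j]) := by
  have hl := hd.orderPreserving p i j hi hj hij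
  have yi := hd.upward p i hi
  have yj := hd.upward p j hj
  have h' : (d.x p : ℝ) ≤ d.x (p ++ [i]) := by exact_mod_cast h
  simp only [LeftOf, point, Prod.fst_sub, Prod.snd_sub] at hl
  by_contra! hc
  have hc' : (d.x (p ++ [j]) : ℝ) ≤ d.x p := by exact_mod_cast hc
  rcases hl with hl | hl
  · nlinarith [mul_nonneg (sub_nonneg.2 h') (sub_nonneg.2 yj),
      mul_nonneg (sub_nonneg.2 hc') (sub_nonneg.2 yi)]
  · linarith [hl.2.2.1]

theorem x_lt_of_le {p : List ℕ} {i j : ℕ} (hi : t.IsNode (p ++ [i])) (hj : t.IsNode (p ++ [j]))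
    (hij : i < j) (h : d.x (p ++ [j]) ≤ d.x p) : d.x (p ++ [i]) < d.x p := by
  by_contra! hc
  exact (hd.lt_x_of_le hi hj hij hc).not_ge h

/-- Of two edges to the right, the later one is higher. -/
theorem height_lt_right {p : List ℕ} {i j : ℕ} {c : ℤ} (hi : t.IsNode (p ++ [i]))
    (hj : t.IsNode (p ++ [j])) (hij : i < j) (h : d.x p < d.x (p ++ [i])) (hc : d.x p < c) :
    d.height p i c < d.height p j c := by
  have hl := hd.orderPreserving p i j hi hj hij
  have h' := hd.lt_x_of_le hi hj hij h.le
  have a : (0 : ℝ) < d.x (p ++ [i]) - d.x p := sub_pos.2 (by exact_mod_cast h)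
  have b : (0 : ℝ) < d.x (p ++ [j]) - d.x p := sub_pos.2 (by exact_mod_cast h')
  have e : (0 : ℝ) < c - d.x p := sub_pos.2 (by exact_mod_cast hc)
  simp only [LeftOf, point, Prod.fst_sub, Prod.snd_sub] at hl
  have : (d.y (p ++ [i]) - d.y p) / (d.x (p ++ [i]) - d.x p) <
      (d.y (p ++ [j]) - d.y p) / (d.x (p ++ [j]) - d.x p) := by
    rw [div_lt_div_iff₀ a b]
    rcases hl with hl | hl
    · linarith
    · linarith [hl.2.2.1]
  simp only [height]
  nlinarith

/-- Of two edges to the left, the earlier one is higher. -/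
theorem height_lt_left {p : List ℕ} {i j : ℕ} {c : ℤ} (hi : t.IsNode (p ++ [i]))
    (hj : t.IsNode (p ++ [j])) (hij : i < j) (h : d.x (p ++ [j]) < d.x p) (hc : c < d.x p) :
    d.height p j c < d.height p i c := by
  have hl := hd.orderPreserving p i j hi hj hij
  have h' := hd.x_lt_of_le hi hj hij h.le
  have a : (d.x (p ++ [i]) : ℝ) - d.x p < 0 := sub_neg.2 (by exact_mod_cast h')
  have b : (d.x (p ++ [j]) : ℝ) - d.x p < 0 := sub_neg.2 (by exact_mod_cast h)
  have e : (c : ℝ) - d.x p < 0 := sub_neg.2 (by exact_mod_cast hc)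
  simp only [LeftOf, point, Prod.fst_sub, Prod.snd_sub] at hl
  have : (d.y (p ++ [i]) - d.y p) / (d.x (p ++ [i]) - d.x p) <
      (d.y (p ++ [j]) - d.y p) / (d.x (p ++ [j]) - d.x p) := by
    rw [← neg_div_neg_eq, ← neg_div_neg_eq (d.y (p ++ [j]) - d.y p),
      div_lt_div_iff₀ (by linarith) (by linarith)]
    rcases hl with hl | hl
    · linarith
    · linarith [hl.2.2.2]
  simp only [height]
  nlinarith

/-! ### Two obstructions -/

/-- A node `u` above an edge that starts at a node `q` not below `u` has no child in or
beyond the column of `q`: the edge to that child would have to cross the given edge, as it would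
meet the column of `q` below `q`. -/
theorem shield {q u : List ℕ} {j k : ℕ} (hq : t.IsNode q) (hj : t.IsNode (q ++ [j]))
    (hk : t.IsNode (u ++ [k])) (hx : d.x u ≠ d.x q) (hju : d.Spans q j (d.x u))
    (hkq : d.Spans u k (d.x q)) (habove : d.height q j (d.x u) < d.y u) (hy : d.y u ≤ d.y q)
    (h1 : q ≠ u) (h2 : q ≠ u ++ [k]) : False := by
  have hne : d.x u ≠ d.x (u ++ [k]) := by unfold Spans at hkq; omega
  have h := hd.height_ne hk hq hkq hne h1 h2
  have hle := (hd.height_le hk hkq).trans hy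
  refine hd.no_cross hj hk (c := d.x u) (c' := d.x q) hju (by unfold Spans; omega)
    (by unfold Spans; omega) hkq ?_ ?_
  · rwa [height_parent k rfl]
  · rw [height_parent j rfl]
    exact lt_of_le_of_ne hle h

/-- Let one child of `p` be straight below `p` and another one not. Then it is impossible that
the former has a child at or beyond the column of the latter and the latter has a child at or
beyond the column of the former: both edges would have to pass below the other child. -/
theorem down_side {p : List ℕ} {i j k l : ℕ} (hp : t.IsNode p)
    (hi : t.IsNode (p ++ [i])) (hj : t.IsNode (p ++ [j])) (hk : t.IsNode (p ++ [i] ++ [k]))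
    (hl : t.IsNode (p ++ [j] ++ [l])) (hdown : d.x (p ++ [i]) = d.x p)
    (hside : d.x (p ++ [j]) ≠ d.x p) (hks : d.Spans (p ++ [i]) k (d.x (p ++ [j])))
    (hls : d.Spans (p ++ [j]) l (d.x p)) : False := by
  have hij : i ≠ j := by rintro rfl; exact hside hdown
  have hnk : d.x (p ++ [i]) ≠ d.x (p ++ [i] ++ [k]) := by unfold Spans at hks; omega
  have hnl : d.x (p ++ [j]) ≠ d.x (p ++ [j] ++ [l]) := by unfold Spans at hls; omega
  have low : d.height (p ++ [j]) l (d.x p) < d.y (p ++ [i]) :=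
    hd.height_lt_of_vertical hi hl hdown hls hnl
      ((hd.height_le hl hls).trans (hd.upward p j hj)) (by simp) (by simpa using hij) (by simp)
      (by simp)
  have hlt : d.y (p ++ [i]) < d.y p :=
    lt_of_le_of_ne (hd.upward p i hi) (hd.y_ne hi hp hdown (by simp))
  have hne := hd.height_ne hk hj hks hnk (by simpa using hij.symm) (by simp)
  have low' : d.height (p ++ [i]) k (d.x (p ++ [j])) < d.y (p ++ [j]) := by
    refine lt_of_le_of_ne (not_lt.1 fun hgt => ?_) hne
    refine hd.no_cross hk hj (c := d.x p) (c' := d.x (p ++ [j])) (by unfold Spans; omega)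
      (by unfold Spans; omega) hks (by unfold Spans; omega) ?_ ?_
    · rwa [height_parent k hdown, height_parent j rfl]
    · rwa [height_child rfl hside.symm]
  refine hd.no_cross hl hk (c := d.x p) (c' := d.x (p ++ [j])) hls (by unfold Spans; omega)
    (by unfold Spans; omega) hks ?_ ?_
  · rwa [height_parent k hdown]
  · rwa [height_parent l rfl]

/-! ### Drawings in three columns -/

/-- With three columns, a node with at least three children, the first three of which have at
least two children each, is not in the middle column. -/
theorem x_ne_two (hw : d.FitsColumns t 0 3) {v : List ℕ} (hv : t.IsNode v)
    (h0 : t.IsNode (v ++ [0])) (h1 : t.IsNode (v ++ [1])) (h2 : t.IsNode (v ++ [2]))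
    (h00 : t.IsNode (v ++ [0] ++ [0])) (h01 : t.IsNode (v ++ [0] ++ [1]))
    (h10 : t.IsNode (v ++ [1] ++ [0])) (h11 : t.IsNode (v ++ [1] ++ [1]))
    (h20 : t.IsNode (v ++ [2] ++ [0])) (h21 : t.IsNode (v ++ [2] ++ [1])) :
    d.x v ≠ 2 := by
  intro xv
  have b0 := hw _ h0
  have b1 := hw _ h1
  have b2 := hw _ h2
  have b00 := hw _ h00
  have b01 := hw _ h01
  have b10 := hw _ h10
  have b11 := hw _ h11
  have b20 := hw _ h20
  have b21 := hw _ h21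
  simp only [add_zero, Nat.cast_ofNat] at b0 b1 b2 b00 b01 b10 b11 b20 b21
  rcases lt_trichotomy (d.x (v ++ [1])) 2 with x1 | x1 | x1
  · -- The first child lies above the edge to the second one, so it has no child to the right.
    have x0 := hd.x_lt_of_le h0 h1 (by norm_num) (by omega)
    have x01 : d.x (v ++ [0]) < d.x (v ++ [0] ++ [1]) := hd.lt_x_of_le h00 h01 (by norm_num)
      (by omega)
    refine hd.shield hv h1 h01 (by omega) (by unfold Spans; omega) (by unfold Spans; omega) ?_
      (hd.upward _ _ h0) (by simp) (by simp)
    have := hd.height_lt_left h0 h1 (c := d.x (v ++ [0])) (by norm_num) (by omega) (by omega)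
    rwa [height_child (i := 0) rfl (by omega)] at this
  · have x0 := hd.x_lt_of_le h0 h1 (by norm_num) (by omega)
    have x2 := hd.lt_x_of_le h1 h2 (by norm_num) (by omega)
    have x01 : d.x (v ++ [0]) < d.x (v ++ [0] ++ [1]) := hd.lt_x_of_le h00 h01 (by norm_num)
      (by omega)
    have x20 : d.x (v ++ [2] ++ [0]) < d.x (v ++ [2]) := hd.x_lt_of_le h20 h21 (by norm_num)
      (by omega)
    by_cases x10 : d.x (v ++ [1] ++ [0]) < 2
    · exact hd.down_side hv h1 h0 h10 h01 (by omega) (by omega) (by unfold Spans; omega)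
        (by unfold Spans; omega)
    · have x11 := hd.lt_x_of_le h10 h11 (by norm_num) (by omega)
      exact hd.down_side hv h1 h2 h11 h20 (by omega) (by omega) (by unfold Spans; omega)
        (by unfold Spans; omega)
  · have x2 := hd.lt_x_of_le h1 h2 (by norm_num) (by omega)
    have x20 : d.x (v ++ [2] ++ [0]) < d.x (v ++ [2]) := hd.x_lt_of_le h20 h21 (by norm_num)
      (by omega)
    refine hd.shield hv h1 h20 (by omega) (by unfold Spans; omega) (by unfold Spans; omega) ?_
      (hd.upward _ _ h2) (by simp) (by simp)
    have := hd.height_lt_right h1 h2 (c := d.x (v ++ [2])) (by norm_num) (by omega) (by omega)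
    rwa [height_child (i := 2) rfl (by omega)] at this

/-- Let `v` be in column `1`, and let it have a child `Q` to the right and a later child `P` in
column `3`. An edge from `P` to the left either ends in column `2` above the edge to `Q`, or it
passes below `Q`, and then it cuts `Q` off from column `3`. -/
theorem above_or_cut_off (hw : d.FitsColumns t 0 3) {v : List ℕ} {i j k : ℕ} (hv : t.IsNode v)
    (hi : t.IsNode (v ++ [i])) (hj : t.IsNode (v ++ [j])) (hk : t.IsNode (v ++ [j] ++ [k]))
    (hij : i < j) (xv : d.x v = 1) (xi : 1 < d.x (v ++ [i])) (xj : d.x (v ++ [j]) = 3)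
    (xk : d.x (v ++ [j] ++ [k]) < 3) :
    (d.x (v ++ [j] ++ [k]) = 2 ∧ d.height v i 2 < d.y (v ++ [j] ++ [k])) ∨
      (d.x (v ++ [i]) = 2 ∧ ∀ l, t.IsNode (v ++ [i] ++ [l]) → d.x (v ++ [i] ++ [l]) < 3) := by
  have bi := hw _ hi
  have bk := hw _ hk
  simp only [add_zero, Nat.cast_ofNat] at bi bk
  have hne : i ≠ j := hij.ne
  have slope : ∀ {c : ℤ}, 1 < c → d.height v i c < d.height v j c := fun hc =>
    hd.height_lt_right hi hj hij (by omega) (by omega)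
  have slope3 := slope (c := 3) (by norm_num)
  rw [height_child (i := j) xj (by omega)] at slope3
  have yk : d.y (v ++ [j] ++ [k]) ≤ d.y v := (hd.upward _ _ hk).trans (hd.upward _ _ hj)
  have at1 : d.x (v ++ [j] ++ [k]) = 1 → d.height (v ++ [j]) k 1 < d.height v i 1 := fun x1 => by
    rw [height_child x1 (by omega), height_parent i xv]
    exact lt_of_le_of_ne yk (hd.y_ne hk hv (by omega) (by simp))
  obtain x3 | x2 : d.x (v ++ [i]) = 3 ∨ d.x (v ++ [i]) = 2 := by omega
  · left
    have order : d.height v i 3 < d.height (v ++ [j]) k 3 := by rwa [height_parent k xj]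
    obtain k1 | k2 : d.x (v ++ [j] ++ [k]) = 1 ∨ d.x (v ++ [j] ++ [k]) = 2 := by omega
    · exact (hd.no_cross hi hk (c := 3) (c' := 1) (by unfold Spans; omega) (by unfold Spans; omega)
        (by unfold Spans; omega) (by unfold Spans; omega) order (at1 k1)).elim
    · refine ⟨k2, lt_of_le_of_ne (not_lt.1 fun hlt => ?_) ?_⟩
      · refine hd.no_cross hi hk (c := 3) (c' := 2) (by unfold Spans; omega)
          (by unfold Spans; omega) (by unfold Spans; omega) (by unfold Spans; omega) order ?_
        rwa [height_child k2 (by omega)]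
      · have := hd.height_ne hi hk (by unfold Spans; omega) (by omega) (by simp) (by simp)
        rwa [k2] at this
  · have htwo : d.height v i 2 = d.y (v ++ [i]) := height_child x2 (by omega)
    have hside := hd.height_ne hk hi (by unfold Spans; omega) (by omega) (by simpa using hne)
      (by simp)
    rw [x2] at hside
    rcases lt_or_gt_of_ne hside with hlt | hgt
    · right
      refine ⟨x2, fun l hl => ?_⟩
      have bl := hw _ hl
      simp only [add_zero, Nat.cast_ofNat] at bl
      by_contra hl3
      have xl : d.x (v ++ [i] ++ [l]) = 3 := by omega
      have slope2 := slope (c := 2) (by norm_num)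
      rw [htwo] at slope2
      -- The edge from `Q` to column `3` has to end below `P`.
      have low : d.y (v ++ [i] ++ [l]) < d.y (v ++ [j]) := by
        refine lt_of_le_of_ne (not_lt.1 fun hh => ?_) (hd.y_ne hl hj (by omega) (by simp))
        refine hd.no_cross hl hj (c := 2) (c' := 3) (by unfold Spans; omega)
          (by unfold Spans; omega) (by unfold Spans; omega) (by unfold Spans; omega) ?_ ?_
        · rwa [height_parent l x2]
        · rwa [height_child xl (by omega), height_child xj (by omega)]
      refine hd.no_cross hk hl (c := 2) (c' := 3) (by unfold Spans; omega)
        (by unfold Spans; omega) (by unfold Spans; omega) (by unfold Spans; omega) ?_ ?_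
      · rwa [height_parent l x2]
      · rwa [height_child xl (by omega), height_parent k xj]
    · left
      obtain k1 | k2 : d.x (v ++ [j] ++ [k]) = 1 ∨ d.x (v ++ [j] ++ [k]) = 2 := by omega
      · exact (hd.no_cross hi hk (c := 2) (c' := 1) (by unfold Spans; omega)
          (by unfold Spans; omega) (by unfold Spans; omega) (by unfold Spans; omega)
          (by rwa [htwo]) (at1 k1)).elim
      · rw [height_child k2 (by omega)] at hgt
        exact ⟨k2, by rwa [htwo]⟩

/-- A node in column `2` above a rightward edge from a node in column `1` which is not below it
has no child in column `1`. -/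
theorem one_lt_x_of_above (hw : d.FitsColumns t 0 3) {v u : List ℕ} {i k : ℕ} (hv : t.IsNode v)
    (hi : t.IsNode (v ++ [i])) (hk : t.IsNode (u ++ [k])) (xv : d.x v = 1)
    (xi : 1 < d.x (v ++ [i])) (xu : d.x u = 2) (habove : d.height v i 2 < d.y u)
    (hy : d.y u ≤ d.y v) (h1 : v ≠ u) (h2 : v ≠ u ++ [k]) : 1 < d.x (u ++ [k]) := by
  have bk := hw _ hk
  simp only [add_zero] at bk
  by_contra hle
  refine hd.shield hv hi hk (by omega) (by unfold Spans; omega) (by unfold Spans; omega) ?_ hy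
    h1 h2
  rwa [xu]

/-- If, in the situation of `above_or_cut_off`, the first child of `P` has two children and ends
above the edge to `Q`, then the second child of `P` is straight below `P`, and the second child of
the first one is in column `3`. -/
theorem down_of_above (hw : d.FitsColumns t 0 3) {v : List ℕ} {i j : ℕ} (hv : t.IsNode v)
    (hi : t.IsNode (v ++ [i])) (hj : t.IsNode (v ++ [j])) (h0 : t.IsNode (v ++ [j] ++ [0]))
    (h1 : t.IsNode (v ++ [j] ++ [1])) (h00 : t.IsNode (v ++ [j] ++ [0] ++ [0]))
    (h01 : t.IsNode (v ++ [j] ++ [0] ++ [1])) (xv : d.x v = 1) (xi : 1 < d.x (v ++ [i]))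
    (xj : d.x (v ++ [j]) = 3) (x0 : d.x (v ++ [j] ++ [0]) = 2)
    (habove : d.height v i 2 < d.y (v ++ [j] ++ [0])) :
    d.x (v ++ [j] ++ [1]) = 3 ∧ d.x (v ++ [j] ++ [0] ++ [1]) = 3 := by
  have b1 := hw _ h1
  have b01 := hw _ h01
  simp only [add_zero, Nat.cast_ofNat] at b1 b01
  have y0 : d.y (v ++ [j] ++ [0]) ≤ d.y v := (hd.upward _ _ h0).trans (hd.upward _ _ hj)
  have x00 := hd.one_lt_x_of_above hw hv hi h00 xv xi x0 habove y0 (by simp) (by simp)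
  have x01 := hd.lt_x_of_le h00 h01 (by norm_num) (by omega)
  refine ⟨?_, by omega⟩
  by_contra hne
  refine hd.shield hj h1 h01 (by omega) (by unfold Spans; omega) (by unfold Spans; omega) ?_
    (hd.upward _ _ h0) (by simp) (by simp)
  have := hd.height_lt_left h0 h1 (c := d.x (v ++ [j] ++ [0])) (by norm_num) (by omega) (by omega)
  rwa [height_child (i := 0) rfl (by omega)] at this

/-- With three columns, let `v` have at least three children, the first three with at least two
children each, and let also the first two children of the third one have at least two
children. Then `v` is not in the first column. -/
theorem x_ne_one (hw : d.FitsColumns t 0 3) {v : List ℕ} (hv : t.IsNode v)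
    (h0 : t.IsNode (v ++ [0])) (h1 : t.IsNode (v ++ [1])) (h2 : t.IsNode (v ++ [2]))
    (h00 : t.IsNode (v ++ [0] ++ [0])) (h01 : t.IsNode (v ++ [0] ++ [1]))
    (h10 : t.IsNode (v ++ [1] ++ [0])) (h11 : t.IsNode (v ++ [1] ++ [1]))
    (h20 : t.IsNode (v ++ [2] ++ [0])) (h21 : t.IsNode (v ++ [2] ++ [1]))
    (h200 : t.IsNode (v ++ [2] ++ [0] ++ [0])) (h201 : t.IsNode (v ++ [2] ++ [0] ++ [1]))
    (h210 : t.IsNode (v ++ [2] ++ [1] ++ [0])) (h211 : t.IsNode (v ++ [2] ++ [1] ++ [1])) :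
    d.x v ≠ 1 := by
  intro xv
  have b0 := hw _ h0
  have b1 := hw _ h1
  have b2 := hw _ h2
  have b00 := hw _ h00
  have b01 := hw _ h01
  have b10 := hw _ h10
  have b11 := hw _ h11
  have b20 := hw _ h20
  have b21 := hw _ h21
  have b201 := hw _ h201
  have b210 := hw _ h210
  have b211 := hw _ h211
  simp only [add_zero, Nat.cast_ofNat] at b0 b1 b2 b00 b01 b10 b11 b20 b21 b201 b210 b211
  have x1 := hd.lt_x_of_le h0 h1 (by norm_num) (by omega)
  have x2 := hd.lt_x_of_le h1 h2 (by norm_num) (by omega)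
  have slope : d.height v 1 (d.x (v ++ [2])) < d.y (v ++ [2]) := by
    have := hd.height_lt_right h1 h2 (c := d.x (v ++ [2])) (by norm_num) (by omega) (by omega)
    rwa [height_child (i := 2) rfl (by omega)] at this
  have y2 := hd.upward v 2 h2
  have y20 : d.y (v ++ [2] ++ [0]) ≤ d.y v := (hd.upward _ _ h20).trans y2
  obtain p2 | p3 : d.x (v ++ [2]) = 2 ∨ d.x (v ++ [2]) = 3 := by omega
  · rw [p2] at slope
    have x20 := hd.one_lt_x_of_above hw hv h1 h20 xv (by omega) p2 slope y2 (by simp) (by simp)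
    have x21 := hd.lt_x_of_le h20 h21 (by norm_num) (by omega)
    have x210 := hd.x_lt_of_le h210 h211 (by norm_num) (by omega)
    obtain q2 | q3 : d.x (v ++ [2] ++ [0]) = 2 ∨ d.x (v ++ [2] ++ [0]) = 3 := by omega
    · have low : d.height v 1 2 < d.y (v ++ [2] ++ [0]) := by
        have := hd.height_lt_of_vertical h20 h1 (by omega) (by unfold Spans; omega) (by omega)
          (by rw [p2]; exact slope.le) (by simp) (by simp) (by simp) (by simp)
        rwa [p2] at this
      have x200 := hd.one_lt_x_of_above hw hv h1 h200 xv (by omega) q2 low y20 (by simp) (by simp)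
      have x201 := hd.lt_x_of_le h200 h201 (by norm_num) (by omega)
      exact hd.down_side h2 h20 h21 h201 h210 (by omega) (by omega) (by unfold Spans; omega)
        (by unfold Spans; omega)
    · refine hd.shield h2 h20 h210 (by omega) (by unfold Spans; omega) (by unfold Spans; omega) ?_
        (hd.upward _ _ h21) (by simp) (by simp)
      have := hd.height_lt_right h20 h21 (c := d.x (v ++ [2] ++ [1])) (by norm_num) (by omega)
        (by omega)
      rwa [height_child (i := 1) rfl (by omega)] at this
  · have x20 := hd.x_lt_of_le h20 h21 (by norm_num) (by omega)
    rcases hd.above_or_cut_off hw hv h1 h2 h20 (by norm_num) xv (by omega) p3 (by omega) with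
      ⟨q2, habove⟩ | ⟨q2, hcut⟩
    · obtain ⟨x21, x201⟩ := hd.down_of_above hw hv h1 h2 h20 h21 h200 h201 xv (by omega) p3 q2
        habove
      have x210 := hd.x_lt_of_le h210 h211 (by norm_num) (by omega)
      exact hd.down_side h2 h21 h20 h210 h201 (by omega) (by omega) (by unfold Spans; omega)
        (by unfold Spans; omega)
    · -- The second child has a child in column `1`, below the first child.
      have x11 := hcut 1 h11
      have x10 := hd.x_lt_of_le h10 h11 (by norm_num) (by omega)
      by_cases x0 : d.x (v ++ [0]) = 1
      · have x01 : d.x (v ++ [0]) < d.x (v ++ [0] ++ [1]) := hd.lt_x_of_le h00 h01 (by norm_num)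
          (by omega)
        exact hd.down_side hv h0 h1 h01 h10 (by omega) (by omega) (by unfold Spans; omega)
          (by unfold Spans; omega)
      · refine hd.shield hv h0 h10 (by omega) (by unfold Spans; omega) (by unfold Spans; omega) ?_
          (hd.upward _ _ h1) (by simp) (by simp)
        have := hd.height_lt_right h0 h1 (c := d.x (v ++ [1])) (by norm_num) (by omega) (by omega)
        rwa [height_child (i := 1) rfl (by omega)] at this

/-- With three columns, let `v` be in column `1`, with children `0`, `1`, `2`. If the second child
has children `k`, `k + 1`, `k + 2` the first of which has two children, and the third child has
three children the first of which has two children, then the third child is not in column `3`. -/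
theorem x_third_ne_three (hw : d.FitsColumns t 0 3) {v : List ℕ} {k : ℕ} (hv : t.IsNode v)
    (h0 : t.IsNode (v ++ [0])) (h1 : t.IsNode (v ++ [1])) (h2 : t.IsNode (v ++ [2]))
    (hk0 : t.IsNode (v ++ [1] ++ [k])) (hk1 : t.IsNode (v ++ [1] ++ [k + 1]))
    (hk2 : t.IsNode (v ++ [1] ++ [k + 2]))
    (hk00 : t.IsNode (v ++ [1] ++ [k] ++ [0])) (hk01 : t.IsNode (v ++ [1] ++ [k] ++ [1]))
    (h20 : t.IsNode (v ++ [2] ++ [0])) (h21 : t.IsNode (v ++ [2] ++ [1]))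
    (h22 : t.IsNode (v ++ [2] ++ [2]))
    (h200 : t.IsNode (v ++ [2] ++ [0] ++ [0])) (h201 : t.IsNode (v ++ [2] ++ [0] ++ [1]))
    (xv : d.x v = 1) : d.x (v ++ [2]) ≠ 3 := by
  intro x2
  have b0 := hw _ h0
  have bk0 := hw _ hk0
  have bk2 := hw _ hk2
  have bk00 := hw _ hk00
  have bk01 := hw _ hk01
  have b22 := hw _ h22
  simp only [add_zero, Nat.cast_ofNat] at b0 bk0 bk2 bk00 bk01 b22
  have x1 := hd.lt_x_of_le h0 h1 (by norm_num) (by omega)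
  have x21 := hd.x_lt_of_le h21 h22 (by norm_num) (by omega)
  have x20 := hd.x_lt_of_le h20 h21 (by norm_num) (by omega)
  rcases hd.above_or_cut_off hw hv h1 h2 h20 (by norm_num) xv (by omega) x2 (by omega) with
    ⟨q2, habove⟩ | ⟨q2, hcut⟩
  · obtain ⟨h, -⟩ := hd.down_of_above hw hv h1 h2 h20 h21 h200 h201 xv (by omega) x2 q2 habove
    omega
  · -- The first two children of the second child are in column `1`, and the edge to the later one
    -- keeps the children of the earlier one there.
    have xk2 := hcut _ hk2
    have xk1 := hd.x_lt_of_le hk1 hk2 (by omega) (by omega)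
    have xk0 := hd.x_lt_of_le hk0 hk1 (by omega) (by omega)
    have xk01 := hd.lt_x_of_le hk00 hk01 (by norm_num) (by omega)
    have bk1 := hw _ hk1
    simp only [add_zero, Nat.cast_ofNat] at bk1
    refine hd.shield h1 hk1 hk01 (by omega) (by unfold Spans; omega) (by unfold Spans; omega) ?_
      (hd.upward _ _ hk0) (by simp) (by simp)
    have := hd.height_lt_left hk0 hk1 (c := d.x (v ++ [1] ++ [k])) (by omega) (by omega) (by omega)
    rwa [height_child (i := k) rfl (by omega)] at this

end IsPlanarUpwardOrderPreserving

end TreeDrawing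

/-! ### Addresses of nodes -/

namespace OrdTree

mutual
/-- The addresses of the nodes of a tree. -/
def addresses : OrdTree → List (List ℕ)
  | node ts => [] :: addressesFrom 0 ts
/-- The addresses of the nodes of the trees in a list, where the trees hang at the children
`i`, `i + 1`, … of a common parent. -/
def addressesFrom (i : ℕ) : List OrdTree → List (List ℕ)
  | [] => []
  | t :: ts => (addresses t).map (i :: ·) ++ addressesFrom (i + 1) ts
end

theorem cons_mem_addressesFrom {s : OrdTree} {p : List ℕ} (hp : p ∈ s.addresses) :
    ∀ {ts : List OrdTree} {i : ℕ} (j : ℕ), ts[i]? = some s →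
      (j + i) :: p ∈ addressesFrom j ts
  | [], i, j, h => by simp at h
  | t :: ts, 0, j, h => by
    obtain rfl : t = s := by simpa using h
    simp [addressesFrom, hp]
  | t :: ts, i + 1, j, h => by
    have := cons_mem_addressesFrom hp (j + 1) (ts := ts) (i := i) (by simpa using h)
    rw [addressesFrom, List.mem_append]
    right
    rwa [show j + (i + 1) = j + 1 + i by omega]

theorem IsNode.mem_addresses : ∀ {p : List ℕ} {t : OrdTree}, t.IsNode p → p ∈ t.addresses
  | [], node ts, _ => by simp [addresses]
  | i :: p, node ts, h => by
    rw [IsNode, subtree?] at h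
    rcases hs : (node ts).children[i]? with - | s
    · simp [hs] at h
    · rw [hs] at h
      have := cons_mem_addressesFrom (IsNode.mem_addresses (t := s) h) 0 (ts := ts) hs
      simp only [addresses, List.mem_cons]
      right
      simpa using this

theorem subtree?_append (t : OrdTree) (p q : List ℕ) :
    t.subtree? (p ++ q) = (t.subtree? p).bind fun s => s.subtree? q := by
  induction p generalizing t with
  | nil => simp [subtree?]
  | cons i p ih =>
    rw [List.cons_append, subtree?, subtree?]
    cases t.children[i]? <;> simp [ih]

theorem isQuaternary_of_addresses {t : OrdTree} (h : ∀ p ∈ t.addresses, 4 ∉ p) :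
    t.IsQuaternary := by
  intro p s hs
  by_contra! hlt
  refine h (p ++ [4]) (IsNode.mem_addresses ?_) (by simp)
  rw [IsNode, subtree?_append, hs]
  simp [subtree?, List.getElem?_eq_getElem hlt]

theorem IsNode.of_append {t : OrdTree} {p q : List ℕ} (h : t.IsNode (p ++ q)) : t.IsNode p := by
  rw [IsNode, subtree?_append] at h
  rw [IsNode]
  cases hs : t.subtree? p <;> simp_all

end OrdTree

/-! ### Checking a drawing with integral coordinates -/

/-- Nodes, given by their addresses, together with integral coordinates. -/
abbrev Layout : Type := List (List ℕ × ℤ × ℤ)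

namespace Layout

/-- The point at which a layout places the node with address `p`, with a default value if it
does not place this node. -/
def pos (l : Layout) (p : List ℕ) : ℤ × ℤ := (l.lookup p).getD (0, 0)

/-- The drawing given by a layout. -/
def toDrawing (l : Layout) : TreeDrawing where
  x p := (l.pos p).1
  y p := (l.pos p).2

/-- A node at `(x, y)` with the given layouts at its children. -/
def fork (x y : ℤ) (ls : List Layout) : Layout :=
  ([], x, y) :: ls.zipIdx.flatMap fun li => li.1.map fun e => (li.2 :: e.1, e.2)

/-- The difference of two points. -/
def vec (a b : ℤ × ℤ) : ℤ × ℤ := (b.1 - a.1, b.2 - a.2)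

/-- The inner product of two vectors. -/
def dot (u v : ℤ × ℤ) : ℤ := u.1 * v.1 + u.2 * v.2

/-- The determinant of two vectors. -/
def det (u v : ℤ × ℤ) : ℤ := u.1 * v.2 - u.2 * v.1

/-- The segments from `e` to `a` and from `e` to `b` have different directions. -/
def Branch (e a b : ℤ × ℤ) : Prop := det (vec e a) (vec e b) ≠ 0 ∨ dot (vec e a) (vec e b) < 0

/-- The linear form with coefficients `n` is smaller at `a` and `b` than at `a'` and `b'`. -/
def SepBy (n a b a' b' : ℤ × ℤ) : Prop :=
  dot n a < dot n a' ∧ dot n a < dot n b' ∧ dot n b < dot n a' ∧ dot n b < dot n b'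

/-- A horizontal line, or a parallel to one of the two segments, separates the segment from `a` to
`b` from the one from `a'` to `b'`. -/
def Apart (a b a' b' : ℤ × ℤ) : Prop :=
  ∃ n ∈ [((0 : ℤ), (1 : ℤ)), (a.2 - b.2, b.1 - a.1), (a'.2 - b'.2, b'.1 - a'.1)],
    SepBy n a b a' b' ∨ SepBy n a' b' a b

instance (e a b : ℤ × ℤ) : Decidable (Branch e a b) := inferInstanceAs (Decidable (_ ∨ _))
instance (n a b a' b' : ℤ × ℤ) : Decidable (SepBy n a b a' b') :=
  inferInstanceAs (Decidable (_ ∧ _ ∧ _ ∧ _))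
instance (a b a' b' : ℤ × ℤ) : Decidable (Apart a b a' b') :=
  inferInstanceAs (Decidable (∃ n ∈ _, _))

/-- Integral points as points of the real plane. -/
def toReal (a : ℤ × ℤ) : ℝ × ℝ := ((a.1 : ℝ), (a.2 : ℝ))

theorem mem_segment_toReal {a b : ℤ × ℤ} {z : ℝ × ℝ} (hz : z ∈ segment ℝ (toReal a) (toReal b)) :
    ∃ r : ℝ, 0 ≤ r ∧ r ≤ 1 ∧ z.1 = a.1 + r * (b.1 - a.1) ∧ z.2 = a.2 + r * (b.2 - a.2) := by
  obtain ⟨u, r, hu, hr, hur, rfl⟩ := hz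
  obtain rfl : u = 1 - r := by linarith
  exact ⟨r, hr, by linarith, by simp [toReal]; ring, by simp [toReal]; ring⟩

theorem SepBy.false {n a b a' b' : ℤ × ℤ} (h : SepBy n a b a' b') {z : ℝ × ℝ}
    (hz : z ∈ segment ℝ (toReal a) (toReal b)) (hz' : z ∈ segment ℝ (toReal a') (toReal b')) :
    False := by
  obtain ⟨r, h0, h1, hx, hy⟩ := mem_segment_toReal hz
  obtain ⟨r', h0', h1', hx', hy'⟩ := mem_segment_toReal hz'
  obtain ⟨s1, s2, s3, s4⟩ := h
  simp only [dot] at s1 s2 s3 s4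
  have e1 : (n.1 * a.1 + n.2 * a.2 : ℝ) < n.1 * a'.1 + n.2 * a'.2 := by exact_mod_cast s1
  have e2 : (n.1 * a.1 + n.2 * a.2 : ℝ) < n.1 * b'.1 + n.2 * b'.2 := by exact_mod_cast s2
  have e3 : (n.1 * b.1 + n.2 * b.2 : ℝ) < n.1 * a'.1 + n.2 * a'.2 := by exact_mod_cast s3
  have e4 : (n.1 * b.1 + n.2 * b.2 : ℝ) < n.1 * b'.1 + n.2 * b'.2 := by exact_mod_cast s4
  have lin : (1 - r) * (n.1 * a.1 + n.2 * a.2 : ℝ) + r * (n.1 * b.1 + n.2 * b.2) =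
      (1 - r') * (n.1 * a'.1 + n.2 * a'.2 : ℝ) + r' * (n.1 * b'.1 + n.2 * b'.2) := by
    linear_combination (-n.1 : ℝ) * hx - n.2 * hy + n.1 * hx' + n.2 * hy'
  generalize (n.1 * a.1 + n.2 * a.2 : ℝ) = A at *
  generalize (n.1 * b.1 + n.2 * b.2 : ℝ) = B at *
  generalize (n.1 * a'.1 + n.2 * a'.2 : ℝ) = A' at *
  generalize (n.1 * b'.1 + n.2 * b'.2 : ℝ) = B' at *
  have u : (1 - r) * A + r * B ≤ max A B := by
    nlinarith [le_max_left A B, le_max_right A B]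
  have l : min A' B' ≤ (1 - r') * A' + r' * B' := by
    nlinarith [min_le_left A' B', min_le_right A' B']
  have : max A B < min A' B' := max_lt (lt_min e1 e2) (lt_min e3 e4)
  linarith

theorem Apart.false {a b a' b' : ℤ × ℤ} (h : Apart a b a' b') {z : ℝ × ℝ}
    (hz : z ∈ segment ℝ (toReal a) (toReal b)) (hz' : z ∈ segment ℝ (toReal a') (toReal b')) :
    False := by
  obtain ⟨n, -, h | h⟩ := h
  · exact h.false hz hz'
  · exact h.false hz' hz

theorem Branch.eq {e a b : ℤ × ℤ} (h : Branch e a b) {z : ℝ × ℝ}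
    (hz : z ∈ segment ℝ (toReal e) (toReal a)) (hz' : z ∈ segment ℝ (toReal e) (toReal b)) :
    z = toReal e := by
  obtain ⟨r, h0, h1, hx, hy⟩ := mem_segment_toReal hz
  obtain ⟨r', h0', h1', hx', hy'⟩ := mem_segment_toReal hz'
  simp only [Branch, det, dot, vec] at h
  have ex : r * (a.1 - e.1 : ℝ) = r' * (b.1 - e.1) := by linarith
  have ey : r * (a.2 - e.2 : ℝ) = r' * (b.2 - e.2) := by linarith
  rcases h with h | h
  · have h' : ((a.1 - e.1) * (b.2 - e.2) - (a.2 - e.2) * (b.1 - e.1) : ℝ) ≠ 0 := by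
      exact_mod_cast h
    have hr : r = 0 := by
      refine (mul_eq_zero.1 ?_).resolve_right h'
      linear_combination (b.2 - e.2 : ℝ) * ex - (b.1 - e.1) * ey
    ext <;> simp [toReal, hx, hy, hr]
  · have h' : ((a.1 - e.1) * (b.1 - e.1) + (a.2 - e.2) * (b.2 - e.2) : ℝ) < 0 := by
      exact_mod_cast h
    have key : r * ((a.1 - e.1) ^ 2 + (a.2 - e.2) ^ 2 : ℝ) =
        r' * ((a.1 - e.1) * (b.1 - e.1) + (a.2 - e.2) * (b.2 - e.2) : ℝ) := by
      linear_combination (a.1 - e.1 : ℝ) * ex + (a.2 - e.2) * ey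
    have hr' : r' = 0 := by
      by_contra hne
      have : 0 < r' := lt_of_le_of_ne h0' (Ne.symm hne)
      nlinarith [mul_nonneg h0 (add_nonneg (sq_nonneg (a.1 - e.1 : ℝ)) (sq_nonneg (a.2 - e.2 : ℝ)))]
    ext <;> simp [toReal, hx', hy', hr']

/-- A finite certificate that a layout of nodes with addresses in `A` is planar, upward and
order-preserving and has all nodes in the columns `1`, `2`, `3`. An edge is represented by the
address of its lower end. -/
structure Certificate (l : Layout) (A : List (List ℕ)) : Prop where
  injective : ∀ p ∈ A, ∀ q ∈ A, l.pos p = l.pos q → p = q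
  edges : ∀ p ∈ A, ∀ q ∈ A, p ≠ [] → q ≠ [] → p ≠ q →
    if p.dropLast = q.dropLast then Branch (l.pos p.dropLast) (l.pos p) (l.pos q)
    else if p = q.dropLast then Branch (l.pos p) (l.pos p.dropLast) (l.pos q)
    else if q = p.dropLast then Branch (l.pos q) (l.pos p) (l.pos q.dropLast)
    else Apart (l.pos p.dropLast) (l.pos p) (l.pos q.dropLast) (l.pos q)
  upward : ∀ p ∈ A, (l.pos p).2 ≤ (l.pos p.dropLast).2
  ordered : ∀ p ∈ A, ∀ q ∈ A, p ≠ [] → q ≠ [] → p.dropLast = q.dropLast →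
    p.getLastD 0 < q.getLastD 0 →
      0 < det (vec (l.pos p.dropLast) (l.pos p)) (vec (l.pos p.dropLast) (l.pos q)) ∨
        ((l.pos p).2 = (l.pos p.dropLast).2 ∧ (l.pos q).2 = (l.pos p.dropLast).2 ∧
          (l.pos p).1 < (l.pos p.dropLast).1 ∧ (l.pos p.dropLast).1 < (l.pos q).1)
  columns : ∀ p ∈ A, 1 ≤ (l.pos p).1 ∧ (l.pos p).1 ≤ 3

theorem point_toDrawing (l : Layout) (p : List ℕ) : l.toDrawing.point p = toReal (l.pos p) := rfl

theorem toReal_injective : Function.Injective toReal := fun a b h => by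
  simpa [toReal, Prod.ext_iff] using h

variable {l : Layout} {t : OrdTree}

theorem Certificate.edge_edge (h : l.Certificate t.addresses) {p q : List ℕ} {i j : ℕ}
    (hp : t.IsNode (p ++ [i])) (hq : t.IsNode (q ++ [j])) (hne : p ++ [i] ≠ q ++ [j])
    {z : ℝ × ℝ} (hz : z ∈ l.toDrawing.edge p i ∩ l.toDrawing.edge q j) :
    ∃ v, (v = p ∨ v = p ++ [i]) ∧ (v = q ∨ v = q ++ [j]) ∧ z = l.toDrawing.point v := by
  have key := h.edges _ hp.mem_addresses _ hq.mem_addresses (by simp) (by simp) hne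
  simp only [List.dropLast_concat] at key
  obtain ⟨hz, hz'⟩ := hz
  simp only [TreeDrawing.edge, point_toDrawing] at hz hz' ⊢
  split_ifs at key with h1 h2 h3
  · subst h1
    exact ⟨p, .inl rfl, .inl rfl, key.eq hz hz'⟩
  · subst h2
    exact ⟨p ++ [i], .inr rfl, .inl rfl, key.eq (by rwa [segment_symm]) hz'⟩
  · subst h3
    exact ⟨q ++ [j], .inl rfl, .inr rfl, key.eq hz (by rwa [segment_symm])⟩
  · exact (key.false hz hz').elim

theorem Certificate.isPlanarUpwardOrderPreserving (h : l.Certificate t.addresses)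
    (h0 : t.IsNode ([] ++ [0])) : l.toDrawing.IsPlanarUpwardOrderPreserving t where
  planar :=
    { injective := fun p q hp hq hpq => h.injective p hp.mem_addresses q hq.mem_addresses
        (toReal_injective hpq)
      node_edge := fun q p i hq hi hmem => by
        -- The node is an end of some edge, so that it suffices to know how two edges meet.
        obtain ⟨r, j, hj, hr⟩ : ∃ r j, t.IsNode (r ++ [j]) ∧ (q = r ∨ q = r ++ [j]) := by
          rcases List.eq_nil_or_concat' q with rfl | ⟨r, j, rfl⟩
          · exact ⟨[], 0, h0, .inl rfl⟩
          · exact ⟨r, j, hq, .inr rfl⟩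
        by_cases hne : p ++ [i] = r ++ [j]
        · obtain ⟨rfl, -⟩ := List.append_inj' hne rfl
          rwa [hne]
        · have hmem' : l.toDrawing.point q ∈ l.toDrawing.edge r j := by
            rcases hr with rfl | rfl
            · exact left_mem_segment ℝ _ _
            · exact right_mem_segment ℝ _ _
          obtain ⟨v, hv, -, hz⟩ := h.edge_edge hi hj hne ⟨hmem, hmem'⟩
          have hvn : t.IsNode v := by
            rcases hv with rfl | rfl
            · exact hi.of_append
            · exact hi
          rwa [h.injective q hq.mem_addresses v hvn.mem_addresses (toReal_injective hz)]
      edge_edge := fun p i q j hi hj hne z hz => h.edge_edge hi hj hne hz }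
  upward p i hi := by
    have := h.upward _ hi.mem_addresses
    rw [List.dropLast_concat] at this
    exact Int.cast_le.2 this
  orderPreserving p i j hi hj hij := by
    have := h.ordered _ hi.mem_addresses _ hj.mem_addresses (by simp) (by simp) (by simp)
      (by simpa using hij)
    rw [List.dropLast_concat] at this
    simp only [TreeDrawing.LeftOf, point_toDrawing, toReal, Prod.fst_sub, Prod.snd_sub,
      sub_eq_zero, sub_neg, sub_pos]
    simp only [det, vec, sub_pos] at this
    exact_mod_cast this

end Layout

/-! ### A drawing of width three -/

namespace Layout

/-- A layout of the second subtree of the root without the upper part of its gadget. -/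
def leftLower (fourth : Bool) : Layout :=
  fork 1 (-2) ((if fourth then [fork 1 (-3) []] else []) ++
    [fork 2 (-7) [fork 1 (-8) [], fork 2 (-8) []], fork 2 (-6) [], fork 2 (-5) []])

/-- A layout of the third subtree of the root without the upper part of its gadget. -/
def rightLower (fourth : Bool) : Layout :=
  fork 3 (-20) ([fork 1 (-40) [fork 1 (-41) [], fork 2 (-43) []],
    fork 2 (-50) [fork 1 (-51) [], fork 2 (-51) []],
    fork 1 (-120) [fork 1 (-121) [fork 1 (-122) [], fork 2 (-140) []],
      fork 2 (-130) [fork 2 (-131) [], fork 3 (-140) []]]] ++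
    if fourth then [fork 3 (-71) [fork 2 (-80) [], fork 3 (-80) []]] else [])

/-- A layout of the tree `OrdTree.notCornerTree upper fourth` in three columns. -/
def notCorner (upper fourth : Bool) : Layout :=
  fork 2 0 [fork 1 0 [],
    if upper then fork 1 (-1) [leftLower fourth, fork 2 (-3) [], fork 2 (-2) []]
    else leftLower fourth,
    if upper then fork 3 (-10) [fork 1 (-11) [fork 1 (-12) [], fork 2 (-14) []],
      fork 2 (-16) [fork 1 (-17) [], fork 2 (-17) []], rightLower fourth]
    else rightLower fourth,
    fork 3 0 []]

theorem notCorner_certificate (upper fourth : Bool) :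
    (notCorner upper fourth).Certificate (OrdTree.notCornerTree upper fourth).addresses where
  injective := by revert upper fourth; decide +kernel
  edges := by revert upper fourth; decide +kernel
  upward := by revert upper fourth; decide +kernel
  ordered := by revert upper fourth; decide +kernel
  columns := by revert upper fourth; decide +kernel

end Layout

/-! ### The root is in the middle column -/

namespace TreeDrawing

variable {d : TreeDrawing} {t : OrdTree}

/-- The drawing moved to the right by `s` columns. -/
def translate (d : TreeDrawing) (s : ℤ) : TreeDrawing where
  x p := d.x p + s
  y := d.y

theorem point_translate (s : ℤ) (p : List ℕ) :
    (d.translate s).point p = ((s : ℝ), (0 : ℝ)) + d.point p := by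
  ext <;> simp [translate, point, add_comm]

theorem mem_edge_translate {s : ℤ} {p : List ℕ} {i : ℕ} {z : ℝ × ℝ} :
    z ∈ (d.translate s).edge p i ↔ -((s : ℝ), (0 : ℝ)) + z ∈ d.edge p i := by
  rw [edge, edge, point_translate, point_translate,
    ← mem_segment_translate ℝ ((s : ℝ), (0 : ℝ)) (x := -((s : ℝ), (0 : ℝ)) + z),
    add_neg_cancel_left]

theorem IsPlanarUpwardOrderPreserving.translate (hd : d.IsPlanarUpwardOrderPreserving t) (s : ℤ) :
    (d.translate s).IsPlanarUpwardOrderPreserving t where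
  planar :=
    { injective := fun p q hp hq h => hd.planar.injective p q hp hq (by
        simpa only [point_translate, add_right_inj] using h)
      node_edge := fun q p i hq hi h => hd.planar.node_edge q p i hq hi (by
        simpa only [mem_edge_translate, point_translate, neg_add_cancel_left] using h)
      edge_edge := fun p i q j hi hj hne z hz => by
        obtain ⟨v, hv, hv', h⟩ := hd.planar.edge_edge p i q j hi hj hne _
          ⟨mem_edge_translate.1 hz.1, mem_edge_translate.1 hz.2⟩
        exact ⟨v, hv, hv', by rw [point_translate, ← h, add_neg_cancel_left]⟩ }
  upward := hd.upward
  orderPreserving p i j hi hj hij := by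
    simpa only [point_translate, add_sub_add_left_eq_sub] using hd.orderPreserving p i j hi hj hij

/-- The nodes of `OrdTree.notCornerTree` on which the argument depends. -/
theorem isNode_notCornerTree (upper fourth : Bool) :
    ∀ p ∈ [[], [0], [1], [2], [3], [2, 0], [2, 1], [2, 2], [2, 0, 0], [2, 0, 1], [2, 1, 0],
      [2, 1, 1], [2, 2, 0], [2, 2, 1], [2, 2, 0, 0], [2, 2, 0, 1], [2, 2, 1, 0], [2, 2, 1, 1]],
      (OrdTree.notCornerTree upper fourth).IsNode p := by
  unfold OrdTree.IsNode
  revert upper fourth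
  decide +kernel

/-- In the mirrored gadget, some child of the root with at least two children is followed by two
more children of the root. -/
theorem exists_isNode_notCornerTree (upper fourth : Bool) :
    ∃ k ∈ [0, 1], ∀ p ∈ [[1, k], [1, k + 1], [1, k + 2], [1, k, 0], [1, k, 1]],
      (OrdTree.notCornerTree upper fourth).IsNode p := by
  unfold OrdTree.IsNode
  revert upper fourth
  decide +kernel

/-- In every drawing of `OrdTree.notCornerTree` in three columns, the root is in the middle column.
The width of the drawing is not assumed to be exactly three. -/
theorem IsPlanarUpwardOrderPreserving.x_root {upper fourth : Bool}
    (hd : d.IsPlanarUpwardOrderPreserving (OrdTree.notCornerTree upper fourth)) {s : ℤ}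
    (hs : d.FitsColumns (OrdTree.notCornerTree upper fourth) s 3) : d.x [] + s = 2 := by
  have hd' := hd.translate s
  have hw : (d.translate s).FitsColumns (OrdTree.notCornerTree upper fourth) 0 3 := by
    simpa only [FitsColumns, TreeDrawing.translate, add_zero] using hs
  change (d.translate s).x [] = 2
  generalize d.translate s = e at hd' hw
  have N := isNode_notCornerTree upper fourth
  simp only [List.forall_mem_cons] at N
  obtain ⟨n, n0, n1, n2, n3, n20, n21, n22, n200, n201, n210, n211, n220, n221, n2200, n2201,
    n2210, n2211, -⟩ := N
  have b := hw _ n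
  have b2 := hw _ n2
  have b3 := hw _ n3
  simp only [add_zero, Nat.cast_ofNat] at b b2 b3
  have x2 : e.x [2] ≠ 2 :=
    hd'.x_ne_two hw n2 n20 n21 n22 n200 n201 n210 n211 n220 n221
  have x1 : e.x [2] ≠ 1 :=
    hd'.x_ne_one hw n2 n20 n21 n22 n200 n201 n210 n211 n220 n221 n2200 n2201 n2210 n2211
  obtain h | h | h : e.x [] = 1 ∨ e.x [] = 2 ∨ e.x [] = 3 := by omega
  · obtain ⟨k, -, M⟩ := exists_isNode_notCornerTree upper fourth
    simp only [List.forall_mem_cons] at M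
    obtain ⟨m0, m1, m2, m00, m01, -⟩ := M
    have x3 : e.x [2] ≠ 3 :=
      hd'.x_third_ne_three hw n n0 n1 n2 m0 m1 m2 m00 m01 n20 n21 n22 n200 n201 h
    omega
  · exact h
  · have : e.x [2] < e.x [] := hd'.x_lt_of_le (p := []) n2 n3 (by norm_num) (by
      change e.x [3] ≤ _; omega)
    omega

end TreeDrawing

theorem mainTheorem5 (upper fourth : Bool) :
    (OrdTree.notCornerTree upper fourth).IsQuaternary ∧
    (∃ d : TreeDrawing,
      d.IsPlanarUpwardOrderPreserving (OrdTree.notCornerTree upper fourth) ∧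
      d.HasWidth (OrdTree.notCornerTree upper fourth) 3) ∧
    (∀ d : TreeDrawing,
      d.IsPlanarUpwardOrderPreserving (OrdTree.notCornerTree upper fourth) →
      d.HasWidth (OrdTree.notCornerTree upper fourth) 3 →
      ∀ s : ℤ, d.FitsColumns (OrdTree.notCornerTree upper fourth) s 3 →
        d.x [] + s = 2) := by
  refine ⟨OrdTree.isQuaternary_of_addresses (by revert upper fourth; decide +kernel), ?_,
    fun d hd _ s hs => hd.x_root hs⟩
  have cert := Layout.notCorner_certificate upper fourth
  have hd := cert.isPlanarUpwardOrderPreserving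
    (TreeDrawing.isNode_notCornerTree upper fourth [0] (by simp))
  refine ⟨_, hd, ⟨0, fun p hp => ?_⟩, fun W hW => ?_⟩
  · have := cert.columns p hp.mem_addresses
    simpa [Layout.toDrawing] using this
  · -- A narrower drawing would fit into three columns in two ways, with the root in column `2`
    -- both times.
    obtain ⟨s, hs⟩ := hW
    by_contra! hlt
    have hlt' : (W : ℤ) < 3 := by exact_mod_cast hlt
    have h1 := hd.x_root (s := s) fun p hp => by
      have := hs p hp
      push_cast
      omega
    have h2 := hd.x_root (s := s + 1) fun p hp => by
      have := hs p hp
      push_cast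
      omega
    omega
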